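/- Let $n\ge 2$ and let a stochastic cooperative game on the players $[n]$ be given by probability distributions $\mathbb P_S$ on $[0,1]$, $S\subseteq[n]$, with means $\mu(S)$ and $\mu(\varnothing)=0$. The game is $\varsigma$-strictly convex ($\varsigma>0$) if $\mu$ is supermodular and $\mu(S\cup\{i\})-\mu(S)\ge\mu(C\cup\{i\})-\mu(C)+\varsigma$ for all $C\subsetneq S$, $i\notin S$. The expected core is $\{x\in\mathbb R^n: \sum_{i} x_i=\mu([n]),\ \sum_{i\in S}x_i\ge\mu(S)\ \forall S\subseteq[n]\}$. For a permutation $\omega$ of $[n]$ let $P^\omega_i=\{j:\omega(j)\le\omega(i)\}$ and let $\phi^\omega$ be the marginal vector, $\phi^\omega_i=\mu(P^\omega_i)-\mu(P^\omega_i\setminus i)$. For points $x^1,\dots,x^n\in\mathbb R^n$ the width is the minimum over $i$ of the smallest, i.e. $(n-1)$-th, singular value of the $n\times(n-1)$ matrix with columns $x^j-x^i$, $j\ne i$. Let $\delta\in(0,1]$ and let $\omega_1,\dots,\omega_n$ be the cyclic permutations, i.e. the powers of the full cycle $i\mapsto i+1 \pmod n$. The algorithm $\texttt{Common-Points-Picking}$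 (which knows $n$, $\mu([n])$ and $\delta$, but neither $\varsigma$ nor $c_W$) runs in epochs $\mathrm{ep}=1,2,\dots$. In every epoch it queries $P^{\omega_p}_i$ for all $p,i\in[n]$ (so $n^2$ samples per epoch), the reward $r_{\mathrm{ep}}(S)$ of a queried coalition $S$ being drawn from $\mathbb P_S$ independently of everything else, with the conventions $r_{\mathrm{ep}}(\varnothing)=0$ and $r_{\mathrm{ep}}([n])=\mu([n])$. It then computes $$\hat\phi^{p}_i=\frac1{\mathrm{ep}}\sum_{s=1}^{\mathrm{ep}}\bigl(r_s(P^{\omega_p}_i)-r_s(P^{\omega_p}_i\setminus i)\bigr),\qquad b=\sqrt{\frac{2\log(n\,\mathrm{ep}\,\delta^{-1})}{\mathrm{ep}}},\qquad \epsilon=2\sqrt n\,b .$$ It stops after the first epoch in which for every $p\in[n]$ there are $v\in\mathbb R^n$ and $c\in\mathbb R$ with $\|v\|_2=1$, $\langle v,\mathbf 1\rangle=0$, $\langle v,\hat\phi^{q}\rangle=c+\epsilon$ for all $q\ne p$, $\langle v,\hat\phi^{p}\rangle<c+\epsilon$, and $\inf\{c-\langle v,x\rangle:\|x-\hat\phi^{p}\|_\infty<b\}\ge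 n\epsilon$; it then returns $x^\star=\frac1n\sum_{p}\hat\phi^{p}$. There is a universal constant $K>0$ such that the following holds for all $n\ge2$, all $\varsigma>0$, $c_W>0$, $\delta\in(0,1]$ and every $\varsigma$-strictly convex game as above: if the width of the simplex with vertices $\phi^{\omega_1},\dots,\phi^{\omega_n}$ is at least $n\varsigma/c_W$, then with probability at least $1-\delta$ the algorithm terminates after a number $T$ of samples with $$T\le K\,\frac{n^5c_W^4\log\bigl(n\,c_W\,\delta^{-1}\varsigma^{-1}\bigr)}{\varsigma^4}$$ and returns a point of the expected core. -/

import Mathlib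

open MeasureTheory ProbabilityTheory

/-! ### Stochastic cooperative games -/

/-- A stochastic cooperative game on the player set `Fin n`: every coalition `S` has a reward
distribution, a probability measure on `[0, 1]`. -/
abbrev StochasticGame (n : ℕ) : Type := Finset (Fin n) → ProbabilityMeasure unitInterval

/-- The expected reward `μ(S)` of the coalition `S`. -/
noncomputable def expectedReward {n : ℕ} (G : StochasticGame n) (S : Finset (Fin n)) : ℝ :=
  ∫ x : unitInterval, (x : ℝ) ∂(G S : Measure unitInterval)

/-- Supermodularity of a set function. -/
def IsSupermodular {n : ℕ} (μ : Finset (Fin n) → ℝ) : Prop :=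
  ∀ (C S : Finset (Fin n)) (i : Fin n), C ⊆ S → i ∉ S →
    μ (insert i C) - μ C ≤ μ (insert i S) - μ S

/-- `ς`-strict convexity: the expected reward is supermodular, and marginal contributions grow by
at least `ς` from a coalition to a strictly larger one. -/
def IsStrictlyConvexGame {n : ℕ} (G : StochasticGame n) (ς : ℝ) : Prop :=
  IsSupermodular (expectedReward G) ∧
  ∀ (C S : Finset (Fin n)) (i : Fin n), C ⊂ S → i ∉ S →
    expectedReward G (insert i C) - expectedReward G C + ς ≤
      expectedReward G (insert i S) - expectedReward G S

/-- The expected core. -/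
def expectedCore {n : ℕ} (G : StochasticGame n) : Set (Fin n → ℝ) :=
  {x | ∑ i, x i = expectedReward G Finset.univ ∧
    ∀ S : Finset (Fin n), expectedReward G S ≤ ∑ i ∈ S, x i}

/-! ### Permutation orders, marginal vectors, width -/

/-- The players who come no later than `i` in the order `w`. -/
def prefixSet {n : ℕ} (w : Equiv.Perm (Fin n)) (i : Fin n) : Finset (Fin n) :=
  Finset.univ.filter fun j => w j ≤ w i

/-- The marginal vector of the game for the order `w`. -/
noncomputable def marginalVector {n : ℕ} (G : StochasticGame n) (w : Equiv.Perm (Fin n)) :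
    Fin n → ℝ :=
  fun i => expectedReward G (prefixSet w i) - expectedReward G ((prefixSet w i).erase i)

/-- The `n` cyclic permutations of `Fin n`, i.e. the powers of the full cycle `i ↦ i + 1`. -/
def cyclicPerms (n : ℕ) : Fin n → Equiv.Perm (Fin n) :=
  fun p => finRotate n ^ (p : ℕ)

/-- The `n × (n - 1)` matrix with columns `x j - x i`, `j ≠ i`. -/
def coordMatrix {n : ℕ} (x : Fin n → Fin n → ℝ) (i : Fin n) :
    Matrix (Fin n) {j : Fin n // j ≠ i} ℝ :=
  Matrix.of fun k j => x j k - x i k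

/-- The width of the simplex with vertices `x 0, …, x (n - 1)`: the minimum over `i` of the
`(n - 1)`-th singular value of the coordinate matrix with respect to `x i`. Singular values are in
descending order and indexed from zero, so this is the one of index `n - 2` (for `2 ≤ n`). -/
noncomputable def simplexWidth {n : ℕ} (x : Fin n → Fin n → ℝ) : ℝ :=
  ⨅ i : Fin n, (Matrix.toEuclideanLin (coordMatrix x i)).singularValues (n - 2)

/-! ### The algorithm

`rew s S` is the reward observed in epoch `s` for the coalition `S`. The value `μN` of the grand
coalition is known to the algorithm, which uses it instead of a sampled value. -/

/-- The reward of `S` as used by the algorithm, given the sampled rewards `ρ` of an epoch. -/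
noncomputable def usedReward {n : ℕ} (μN : ℝ) (ρ : Finset (Fin n) → unitInterval)
    (S : Finset (Fin n)) : ℝ :=
  if S = ∅ then 0 else if S = Finset.univ then μN else (ρ S : ℝ)

/-- The empirical marginal vector for the order `w` after `ep` epochs. -/
noncomputable def empiricalMarginal {n : ℕ} (μN : ℝ)
    (rew : ℕ → Finset (Fin n) → unitInterval) (w : Equiv.Perm (Fin n)) (ep : ℕ) : Fin n → ℝ :=
  fun i => (1 / (ep : ℝ)) * ∑ s ∈ Finset.Icc 1 ep,
    (usedReward μN (rew s) (prefixSet w i) - usedReward μN (rew s) ((prefixSet w i).erase i))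

/-- The confidence bonus `b_ep`. -/
noncomputable def confidenceBonus (n : ℕ) (δ : ℝ) (ep : ℕ) : ℝ :=
  Real.sqrt (2 * Real.log ((n : ℝ) * (ep : ℝ) * δ⁻¹) / (ep : ℝ))

/-- `(v, c)` describes the hyperplane `H_p(Q)`: it is parallel to the hyperplane through the
points `Q q`, `q ≠ p`, and at distance `ε` from it, on the side of `Q p`. -/
def IsSeparatingHyperplane {n : ℕ} (Q : Fin n → Fin n → ℝ) (ε : ℝ) (p : Fin n)
    (v : Fin n → ℝ) (c : ℝ) : Prop :=
  ‖WithLp.toLp 2 v‖ = 1 ∧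
  (∀ q, q ≠ p → v ⬝ᵥ Q q = c + ε) ∧
  v ⬝ᵥ Q p < c + ε ∧
  v ⬝ᵥ 1 = 0

/-- The signed distance `h_p` of the box of radius `b` around `Q p` to the hyperplane `(v, c)`. -/
noncomputable def boxDistance {n : ℕ} (Q : Fin n → Fin n → ℝ) (b : ℝ) (p : Fin n)
    (v : Fin n → ℝ) (c : ℝ) : ℝ :=
  sInf ((fun x : Fin n → ℝ => c - v ⬝ᵥ x) '' {x | ‖x - Q p‖ < b})

/-- The stopping condition returns `TRUE`. It fails if for some `p` there is no hyperplane
`H_p(Q)`. If there is one for every `p`, then `Q` is affinely independent, and (as the points of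
`Q` have the same sum of coordinates) each of them is unique. -/
def StoppingCondition {n : ℕ} (Q : Fin n → Fin n → ℝ) (b : ℝ) : Prop :=
  ∀ p : Fin n, ∃ (v : Fin n → ℝ) (c : ℝ),
    IsSeparatingHyperplane Q (2 * Real.sqrt n * b) p v c ∧
    (n : ℝ) * (2 * Real.sqrt n * b) ≤ boxDistance Q b p v c

/-- The stopping condition holds for the estimates made after `ep` epochs. -/
def StopsAtEpoch {n : ℕ} (P : Fin n → Equiv.Perm (Fin n)) (μN δ : ℝ)
    (rew : ℕ → Finset (Fin n) → unitInterval) (ep : ℕ) : Prop :=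
  StoppingCondition (fun p => empiricalMarginal μN rew (P p) ep) (confidenceBonus n δ ep)

/-- On the observations `rew`, `Common-Points-Picking` with the permutation orders `P` and the
confidence parameter `δ` terminates, after exactly `T` queries, and returns `x`. It stops after the
first epoch `ep ≥ 1` whose estimates satisfy the stopping condition; every epoch makes one query for
each pair of an order and a player, i.e. `n * n` queries. -/
def CommonPointsPickingReturns {n : ℕ} (P : Fin n → Equiv.Perm (Fin n)) (μN δ : ℝ)
    (rew : ℕ → Finset (Fin n) → unitInterval) (x : Fin n → ℝ) (T : ℕ) : Prop :=
  ∃ ep : ℕ, 1 ≤ ep ∧ StopsAtEpoch P μN δ rew ep ∧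
    (∀ k, 1 ≤ k → k < ep → ¬ StopsAtEpoch P μN δ rew k) ∧
    x = (1 / (n : ℝ)) • ∑ p, empiricalMarginal μN rew (P p) ep ∧
    T = ep * (n * n)

/-- The observations of the game `G`: the reward of the coalition `S` in epoch `s` has the law
`G S`, and all rewards are mutually independent. (Within an epoch, the proper nonempty prefixes of
the cyclic orders are pairwise different, so each is queried once; the grand coalition is the only
one queried repeatedly, and its sampled values are not used.) -/
structure IsSampling {n : ℕ} (G : StochasticGame n) {Ω : Type*} [MeasurableSpace Ω]
    (Pr : Measure Ω) (r : ℕ → Finset (Fin n) → Ω → unitInterval) : Prop where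
  measurable : ∀ s S, Measurable (r s S)
  law : ∀ s S, Pr.map (r s S) = (G S : Measure unitInterval)
  indep : iIndepFun (fun a : ℕ × Finset (Fin n) => r a.1 a.2) Pr

/-! Write `ρ = cW / ς`, so that the true simplex has width at least `n / ρ`. The argument is
deterministic on the event that, from epoch 3 on, every coordinate of every estimate is within `b`
of its true value.

Correctness (`StoppingCondition.le_dotProduct_mean`): supermodularity puts the true marginal vectors
`y q` in the core. If the algorithm stops at `Q`, each `Q p` is at distance at least `2 * n * √n *
b` from the hyperplane through the other vertices, while `y q - Q q` has length at most `√n * b`.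
Hence `y q - Q q = ∑ t p • Q p` with `∑ t p = 0` and `|t p| ≤ 1 / (2 * n)`. If `f p` is the slack of
a core inequality at `Q p`, its validity at `y q` gives `-f q ≤ (∑ |f p|) / (2 * n)`. Summing over
`q`, the negative slacks make up at most half of the total mass, so the mean of the `Q p` satisfies
the inequality.

Termination (`stoppingCondition_of_width`): the last singular value bounds the heights of the true
simplex from below, and moving each coordinate by `b` costs at most `2 * n * b`. So the algorithm
stops once `n * √n * b` is at most a constant times `n / ρ`, which happens by an epoch of order `n *
ρ ^ 2 * log (n * ρ / δ)`.

Probability (`measure_confidence_ge`): Hoeffding's inequality and a union bound give failure at most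
`δ` when summed from epoch 3; `StoppingCondition.radius_le` rules out stopping earlier. -/

/-! ### Marginal vectors and the core -/

/-- The increments of a set function along a linear order of the players telescope. -/
theorem sum_prefixSet_increment {n : ℕ} (u : Finset (Fin n) → ℝ) (w : Equiv.Perm (Fin n)) :
    ∑ i, (u (prefixSet w i) - u ((prefixSet w i).erase i)) = u Finset.univ - u ∅ := by
  -- Generalised to sets closed under predecessors: the prefix of the last player of such a set is
  -- the set itself, so that player can be peeled off.
  suffices h : ∀ S : Finset (Fin n), (∀ i ∈ S, ∀ j, w j ≤ w i → j ∈ S) →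
      ∑ i ∈ S, (u (prefixSet w i) - u ((prefixSet w i).erase i)) = u S - u ∅ from
    h Finset.univ fun _ _ _ _ => Finset.mem_univ _
  intro S
  induction S using Finset.induction_on_max_value w with
  | empty => simp
  | insert a s ha hmax ih =>
    intro hcl
    have hp : prefixSet w a = insert a s := by
      ext j
      simp only [prefixSet, Finset.mem_filter, Finset.mem_univ, true_and, Finset.mem_insert]
      constructor
      · intro hj
        simpa using hcl a (by simp) j hj
      · rintro (rfl | hj)
        · exact le_rfl
        · exact hmax j hj
    rw [Finset.sum_insert ha, ih, hp, Finset.erase_insert ha]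
    · ring
    · intro i hi j hj
      rcases Finset.mem_insert.1 (hcl i (Finset.mem_insert_of_mem hi) j hj) with rfl | h
      · exact absurd (w.injective (le_antisymm (hmax i hi) hj)) (fun h => ha (h ▸ hi))
      · exact h

/-- Marginal vectors of a supermodular game lie in the core. -/
theorem marginalVector_mem_expectedCore {n : ℕ} {G : StochasticGame n}
    (h0 : expectedReward G ∅ = 0) (hG : IsSupermodular (expectedReward G))
    (w : Equiv.Perm (Fin n)) : marginalVector G w ∈ expectedCore G := by
  refine ⟨?_, fun S => ?_⟩
  · rw [← sub_zero (expectedReward G Finset.univ), ← h0]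
    exact sum_prefixSet_increment (expectedReward G) w
  · induction S using Finset.induction_on_max_value w with
    | empty => simp [h0]
    | insert a s ha hmax ih =>
      rw [Finset.sum_insert ha]
      -- The last player `a` joins all its predecessors, which include `s`, so supermodularity makes
      -- its marginal at least its contribution to `s`.
      have hsub : s ⊆ (prefixSet w a).erase a := by
        intro j hj
        simp only [prefixSet, Finset.mem_erase, Finset.mem_filter, Finset.mem_univ, true_and]
        exact ⟨fun h => ha (h ▸ hj), hmax j hj⟩
      have h := hG s _ a hsub (Finset.notMem_erase _ _)
      rw [Finset.insert_erase (by simp [prefixSet])] at h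
      simp only [marginalVector] at ih ⊢
      linarith

/-! ### Bounds and coordinate sums of the estimates -/

theorem expectedReward_mem_Icc {n : ℕ} (G : StochasticGame n) (S : Finset (Fin n)) :
    expectedReward G S ∈ Set.Icc (0 : ℝ) 1 := by
  refine ⟨integral_nonneg fun x => x.2.1, ?_⟩
  calc expectedReward G S ≤ ∫ _ : unitInterval, (1 : ℝ) ∂(G S : Measure unitInterval) :=
        integral_mono (Integrable.of_mem_Icc 0 1 (by fun_prop) (ae_of_all _ fun x => x.2))
          (integrable_const _) fun x => x.2.2
    _ = 1 := by simp

theorem usedReward_mem_Icc {n : ℕ} {μN : ℝ} (hμ : μN ∈ Set.Icc (0 : ℝ) 1)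
    (ρ : Finset (Fin n) → unitInterval) (S : Finset (Fin n)) :
    usedReward μN ρ S ∈ Set.Icc (0 : ℝ) 1 := by
  unfold usedReward
  split_ifs
  · simp
  · exact hμ
  · exact (ρ S).2

theorem abs_marginalVector_le_one {n : ℕ} (G : StochasticGame n) (w : Equiv.Perm (Fin n))
    (i : Fin n) : |marginalVector G w i| ≤ 1 := by
  have h1 := expectedReward_mem_Icc G (prefixSet w i)
  have h2 := expectedReward_mem_Icc G ((prefixSet w i).erase i)
  rw [marginalVector, abs_le]
  constructor <;> linarith [h1.1, h1.2, h2.1, h2.2]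

theorem abs_empiricalMarginal_le_one {n : ℕ} {μN : ℝ} (hμ : μN ∈ Set.Icc (0 : ℝ) 1)
    (rew : ℕ → Finset (Fin n) → unitInterval) (w : Equiv.Perm (Fin n)) {ep : ℕ} (hep : 1 ≤ ep)
    (i : Fin n) : |empiricalMarginal μN rew w ep i| ≤ 1 := by
  have hpos : (0 : ℝ) < ep := by exact_mod_cast hep
  rw [empiricalMarginal, abs_mul, abs_of_pos (by positivity), one_div, inv_mul_le_iff₀ hpos,
    mul_one]
  calc _ ≤ ∑ s ∈ Finset.Icc 1 ep, (1 : ℝ) := by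
        refine (Finset.abs_sum_le_sum_abs _ _).trans (Finset.sum_le_sum fun s _ => ?_)
        have h1 := usedReward_mem_Icc hμ (rew s) (prefixSet w i)
        have h2 := usedReward_mem_Icc hμ (rew s) ((prefixSet w i).erase i)
        rw [abs_le]
        constructor <;> linarith [h1.1, h1.2, h2.1, h2.2]
    _ = ep := by simp

theorem sum_empiricalMarginal {n : ℕ} (hn : n ≠ 0) (μN : ℝ)
    (rew : ℕ → Finset (Fin n) → unitInterval) (w : Equiv.Perm (Fin n)) {ep : ℕ} (hep : 1 ≤ ep) :
    ∑ i, empiricalMarginal μN rew w ep i = μN := by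
  have hpos : (0 : ℝ) < ep := by exact_mod_cast hep
  have : NeZero n := ⟨hn⟩
  have hne : (Finset.univ : Finset (Fin n)) ≠ ∅ := Finset.univ_nonempty.ne_empty
  simp only [empiricalMarginal]
  rw [← Finset.mul_sum, Finset.sum_comm]
  simp only [sum_prefixSet_increment]
  simp [usedReward, hne, hpos.ne']

/-! ### Correctness of the stopping condition -/

theorem dotProduct_le_norm_mul_norm {ι : Type*} [Fintype ι] (v x : ι → ℝ) :
    |v ⬝ᵥ x| ≤ ‖WithLp.toLp 2 v‖ * ‖WithLp.toLp 2 x‖ := by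
  have h := abs_real_inner_le_norm (WithLp.toLp 2 x) (WithLp.toLp 2 v)
  rw [EuclideanSpace.inner_toLp_toLp, mul_comm] at h
  simpa using h

theorem norm_toLp_le_sqrt_mul {n : ℕ} {x : Fin n → ℝ} {b : ℝ} (hb : 0 ≤ b)
    (h : ∀ i, |x i| ≤ b) : ‖WithLp.toLp 2 x‖ ≤ Real.sqrt n * b := by
  rw [EuclideanSpace.norm_eq, ← Real.sqrt_sq hb, ← Real.sqrt_mul (Nat.cast_nonneg n)]
  apply Real.sqrt_le_sqrt
  calc ∑ i, ‖x i‖ ^ 2 ≤ ∑ _i : Fin n, b ^ 2 :=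
        Finset.sum_le_sum fun i _ => pow_le_pow_left₀ (norm_nonneg _) (h i) 2
    _ = n * b ^ 2 := by simp

theorem dotProduct_sum_smul {ι κ : Type*} [Fintype ι] [Fintype κ] (v : ι → ℝ) (t : κ → ℝ)
    (Q : κ → ι → ℝ) : v ⬝ᵥ (∑ q, t q • Q q) = ∑ q, t q * (v ⬝ᵥ Q q) := by
  rw [dotProduct_sum]
  exact Finset.sum_congr rfl fun q _ => by rw [dotProduct_smul, smul_eq_mul]

/-- If every vertex of a simplex in a hyperplane of constant coordinate sum is separated from the
hyperplane through the others, then the directions `Q p - Q q` span all vectors of coordinate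
sum zero. -/
theorem exists_sum_smul_eq_of_separated {n : ℕ} {Q v : Fin n → Fin n → ℝ} {α d : Fin n → ℝ}
    {m : ℝ} (hQ : ∀ p, ∑ i, Q p i = m) (hd : ∀ p, d p ≠ 0)
    (hne : ∀ p q, q ≠ p → v p ⬝ᵥ Q q = α p) (heq : ∀ p, v p ⬝ᵥ Q p = α p - d p)
    {x : Fin n → ℝ} (hx : ∑ i, x i = 0) :
    ∃ t : Fin n → ℝ, ∑ p, t p = 0 ∧ x = ∑ p, t p • Q p ∧ ∀ p, v p ⬝ᵥ x = -(d p * t p) := by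
  have key : ∀ (t : Fin n → ℝ), ∑ p, t p = 0 → ∀ p,
      v p ⬝ᵥ (∑ q, t q • Q q) = -(d p * t p) := by
    intro t ht p
    rw [dotProduct_sum_smul]
    have : ∀ q, t q * (v p ⬝ᵥ Q q) = t q * α p - if q = p then d p * t p else 0 := by
      intro q
      split_ifs with h
      · subst h
        rw [heq]
        ring
      · rw [hne p q h]
        ring
    simp only [this]
    rw [Finset.sum_sub_distrib, ← Finset.sum_mul, ht]
    simp
  let V : Submodule ℝ (Fin n → ℝ) := LinearMap.ker (∑ i, LinearMap.proj i)
  have hV : ∀ t : Fin n → ℝ, t ∈ V ↔ ∑ i, t i = 0 := by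
    intro t
    simp [V, LinearMap.mem_ker, LinearMap.sum_apply]
  let T : (Fin n → ℝ) →ₗ[ℝ] (Fin n → ℝ) := Fintype.linearCombination ℝ Q
  have hT : ∀ t, T t = ∑ q, t q • Q q := fun t => Fintype.linearCombination_apply ℝ Q t
  have hTV : ∀ t ∈ V, T t ∈ V := by
    intro t ht
    rw [hV] at ht ⊢
    rw [hT]
    simp only [Finset.sum_apply, Pi.smul_apply, smul_eq_mul]
    rw [Finset.sum_comm]
    simp only [← Finset.mul_sum, hQ]
    rw [← Finset.sum_mul, ht, zero_mul]
  -- The functional `v p` reads off the coefficient `t p` up to the nonzero factor `-d p`; an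
  -- injective endomorphism of the sum-zero space is surjective.
  have hinj : Function.Injective (T.restrict hTV) := by
    rw [← LinearMap.ker_eq_bot, LinearMap.ker_eq_bot']
    rintro ⟨t, ht⟩ h0
    have h0' : T t = 0 := congrArg Subtype.val h0
    ext p
    have := key t ((hV t).1 ht) p
    rw [← hT, h0', dotProduct_zero, eq_comm, neg_eq_zero] at this
    exact (mul_eq_zero.1 this).resolve_left (hd p)
  obtain ⟨⟨t, ht⟩, hTt⟩ := LinearMap.injective_iff_surjective.1 hinj ⟨x, (hV x).2 hx⟩
  have hxt : x = ∑ q, t q • Q q := by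
    rw [← hT]
    exact (congrArg Subtype.val hTt).symm
  refine ⟨t, (hV t).1 ht, hxt, fun p => ?_⟩
  rw [hxt]
  exact key t ((hV t).1 ht) p

/-- If every negative entry is dominated by a `1 / (2 * n)` fraction of the total mass,
the sum is nonnegative. -/
theorem sum_nonneg_of_neg_le {n : ℕ} (f : Fin n → ℝ)
    (h : ∀ q, -f q ≤ 1 / (2 * (n : ℝ)) * ∑ p, |f p|) : 0 ≤ ∑ q, f q := by
  rcases Nat.eq_zero_or_pos n with rfl | hn
  · simp
  have hn' : (0 : ℝ) < n := by exact_mod_cast hn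
  -- Termwise, `|f q|` is `f q` plus twice its negative part.
  have h1 : ∑ q, |f q| ≤ ∑ q, f q +
      ∑ _q : Fin n, 2 * (1 / (2 * (n : ℝ)) * ∑ p : Fin n, |f p|) := by
    rw [← Finset.sum_add_distrib]
    refine Finset.sum_le_sum fun q _ => ?_
    have h0 : 0 ≤ 1 / (2 * (n : ℝ)) * ∑ p, |f p| :=
      mul_nonneg (by positivity) (Finset.sum_nonneg fun _ _ => abs_nonneg _)
    rcases abs_cases (f q) with ⟨hq, _⟩ | ⟨hq, _⟩ <;> linarith [h q]
  have h2 : ∑ _q : Fin n, 2 * (1 / (2 * (n : ℝ)) * ∑ p, |f p|) = ∑ p, |f p| := by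
    simp only [Finset.sum_const, Finset.card_univ, Fintype.card_fin, nsmul_eq_mul]
    field_simp
  linarith

theorem boxDistance_le {n : ℕ} (Q : Fin n → Fin n → ℝ) {b : ℝ} (hb : 0 < b) (p : Fin n)
    {v : Fin n → ℝ} (hv : ‖WithLp.toLp 2 v‖ = 1) (c : ℝ) :
    boxDistance Q b p v c ≤ c - v ⬝ᵥ Q p := by
  -- A lower bound has to be exhibited, since `sInf` of a set unbounded below is 0 by default.
  refine csInf_le ⟨c - v ⬝ᵥ Q p - Real.sqrt n * b, ?_⟩ ⟨Q p, by simpa using hb, rfl⟩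
  rintro _ ⟨x, hx, rfl⟩
  replace hx : ‖x - Q p‖ < b := hx
  have h1 : |v ⬝ᵥ (x - Q p)| ≤ Real.sqrt n * b := by
    refine (dotProduct_le_norm_mul_norm _ _).trans ?_
    rw [hv, one_mul]
    exact norm_toLp_le_sqrt_mul hb.le fun i =>
      (norm_le_pi_norm (x - Q p) i).trans (le_of_lt hx)
  rw [dotProduct_sub, abs_le] at h1
  dsimp only
  linarith [h1.2]

/-- When the stopping condition holds, the mean of the estimates satisfies every linear inequality
which is satisfied by some choice of points from the confidence boxes. -/
theorem StoppingCondition.le_dotProduct_mean {n : ℕ} (hn : n ≠ 0) {Q y : Fin n → Fin n → ℝ}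
    {b m : ℝ} (hb : 0 < b) (hS : StoppingCondition Q b) (hQ : ∀ p, ∑ i, Q p i = m)
    (hy : ∀ p, ∑ i, y p i = m) (hyQ : ∀ p i, |y p i - Q p i| ≤ b) (g : Fin n → ℝ) (a : ℝ)
    (ha : ∀ p, a ≤ g ⬝ᵥ y p) : a ≤ g ⬝ᵥ ((1 / (n : ℝ)) • ∑ p, Q p) := by
  have hn' : (0 : ℝ) < n := by exact_mod_cast Nat.pos_of_ne_zero hn
  choose v c hv hbox using hS
  set d : Fin n → ℝ := fun p => c p + 2 * Real.sqrt n * b - v p ⬝ᵥ Q p with hddef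
  have hd : ∀ p, (n : ℝ) * (2 * Real.sqrt n * b) ≤ d p := by
    intro p
    have h1 := (hbox p).trans (boxDistance_le Q hb p (hv p).1 (c p))
    have : 0 ≤ 2 * Real.sqrt n * b := by positivity
    simp only [hddef]
    linarith
  have hsn : 0 < Real.sqrt n := Real.sqrt_pos.2 hn'
  have hdpos : ∀ p, 0 < d p := fun p => lt_of_lt_of_le (by positivity) (hd p)
  set f : Fin n → ℝ := fun p => g ⬝ᵥ Q p - a with hf
  have hneg : ∀ q, -f q ≤ 1 / (2 * (n : ℝ)) * ∑ p, |f p| := by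
    intro q
    have hx : ∑ i, (y q - Q q) i = 0 := by simp [Finset.sum_sub_distrib, hy, hQ]
    obtain ⟨t, ht0, htx, htv⟩ := exists_sum_smul_eq_of_separated (v := v) (d := d) hQ
      (fun p => (hdpos p).ne') (fun p => (hv p).2.1) (fun p => by simp [hddef]) hx
    -- The margin `n * ε` in the stopping rule serves exactly here: `√n * b` divided by `2 * n * √n
    -- * b`.
    have htb : ∀ p, |t p| ≤ 1 / (2 * (n : ℝ)) := by
      intro p
      have h1 : d p * |t p| ≤ Real.sqrt n * b := by
        rw [← abs_of_pos (hdpos p), ← abs_mul, ← abs_neg, ← htv p]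
        refine (dotProduct_le_norm_mul_norm _ _).trans ?_
        rw [(hv p).1, one_mul]
        exact norm_toLp_le_sqrt_mul hb.le (hyQ q)
      have h2 := (mul_le_mul_of_nonneg_right (hd p) (abs_nonneg (t p))).trans h1
      rw [le_div_iff₀ (by positivity)]
      have h3 : (Real.sqrt n * b) * (|t p| * (2 * n)) ≤ (Real.sqrt n * b) * 1 := by
        linarith
      exact le_of_mul_le_mul_left h3 (by positivity)
    have hgx : g ⬝ᵥ (y q - Q q) = ∑ p, t p * f p := by
      rw [htx, dotProduct_sum_smul]
      simp only [hf, mul_sub, Finset.sum_sub_distrib, ← Finset.sum_mul, ht0, zero_mul, sub_zero]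
    have hle : ∑ p, t p * f p ≤ 1 / (2 * (n : ℝ)) * ∑ p, |f p| := by
      rw [Finset.mul_sum]
      refine Finset.sum_le_sum fun p _ => (le_abs_self _).trans ?_
      rw [abs_mul]
      exact mul_le_mul_of_nonneg_right (htb p) (abs_nonneg _)
    rw [dotProduct_sub] at hgx
    have := ha q
    simp only [hf] at hle hgx ⊢
    linarith
  have hsum := sum_nonneg_of_neg_le f hneg
  rw [dotProduct_smul, dotProduct_sum, smul_eq_mul, one_div, le_inv_mul_iff₀ hn']
  simp only [hf, Finset.sum_sub_distrib, Finset.sum_const, Finset.card_univ, Fintype.card_fin,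
    nsmul_eq_mul] at hsum
  linarith

/-- Besides the fixed coordinate sum, the core is cut out by linear inequalities whose normals are
indicators of coalitions. -/
theorem mean_mem_expectedCore {n : ℕ} (hn : n ≠ 0) {G : StochasticGame n}
    {Q y : Fin n → Fin n → ℝ} {b : ℝ} (hb : 0 < b) (hS : StoppingCondition Q b)
    (hQ : ∀ p, ∑ i, Q p i = expectedReward G Finset.univ) (hy : ∀ p, y p ∈ expectedCore G)
    (hyQ : ∀ p i, |y p i - Q p i| ≤ b) : (1 / (n : ℝ)) • ∑ p, Q p ∈ expectedCore G := by
  refine ⟨?_, fun S => ?_⟩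
  · simp only [Pi.smul_apply, Finset.sum_apply, smul_eq_mul]
    rw [← Finset.mul_sum, Finset.sum_comm]
    simp [hQ, hn]
  · have hind : ∀ x : Fin n → ℝ, (fun i => if i ∈ S then (1 : ℝ) else 0) ⬝ᵥ x = ∑ i ∈ S, x i := by
      intro x
      simp [dotProduct]
    have := hS.le_dotProduct_mean hn hb hQ (fun p => (hy p).1) hyQ
      (fun i => if i ∈ S then (1 : ℝ) else 0) (expectedReward G S)
      (fun p => by rw [hind]; exact (hy p).2 S)
    rwa [hind] at this

/-! ### Width, heights and termination -/

/-- The last singular value of a linear map bounds it from below. -/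
theorem LinearMap.singularValues_mul_norm_le {E F : Type*} [NormedAddCommGroup E]
    [InnerProductSpace ℝ E] [FiniteDimensional ℝ E] [NormedAddCommGroup F]
    [InnerProductSpace ℝ F] [FiniteDimensional ℝ F] (T : E →ₗ[ℝ] F) {k : ℕ}
    (hk : Module.finrank ℝ E = k + 1) (z : E) : T.singularValues k * ‖z‖ ≤ ‖T z‖ := by
  refine le_of_sq_le_sq ?_ (norm_nonneg _)
  have hS := T.isSymmetric_adjoint_comp_self
  -- Diagonalise `T* T`: its smallest eigenvalue is the square of the last singular value.
  have hT : ‖T z‖ ^ 2 =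
      ∑ i, hS.eigenvalues hk i * ‖inner ℝ (hS.eigenvectorBasis hk i) z‖ ^ 2 := by
    rw [← real_inner_self_eq_norm_sq, ← LinearMap.adjoint_inner_right, ← LinearMap.comp_apply,
      ← (hS.eigenvectorBasis hk).sum_inner_mul_inner]
    refine Finset.sum_congr rfl fun i _ => ?_
    rw [← OrthonormalBasis.repr_apply_apply _ (_ : E) i,
      hS.eigenvectorBasis_apply_self_apply hk z i, OrthonormalBasis.repr_apply_apply,
      real_inner_comm, Real.norm_eq_abs, sq_abs]
    simp only [RCLike.ofReal_real_eq_id, id_eq]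
    ring
  rw [hT, mul_pow, T.sq_singularValues_of_lt hk (Nat.lt_succ_self k),
    ← (hS.eigenvectorBasis hk).sum_sq_norm_inner_right z, Finset.mul_sum]
  refine Finset.sum_le_sum fun i _ => mul_le_mul_of_nonneg_right ?_ (sq_nonneg _)
  exact hS.eigenvalues_antitone hk (Fin.le_last i)

/-- For weights of sum zero the one at `i` is minus the sum of the others, so `∑ t j • x j` is the
coordinate matrix at `i` applied to the remaining weights. -/
theorem simplexWidth_mul_norm_le {n : ℕ} (hn : 2 ≤ n) (x : Fin n → Fin n → ℝ) (i : Fin n)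
    {t : Fin n → ℝ} (ht : ∑ j, t j = 0) :
    simplexWidth x * ‖WithLp.toLp 2 fun j : {j : Fin n // j ≠ i} => t j‖ ≤
      ‖WithLp.toLp 2 (∑ j, t j • x j)‖ := by
  have hmul : (coordMatrix x i).mulVec (fun j : {j : Fin n // j ≠ i} => t j) =
      ∑ j, t j • x j := by
    ext k
    have h1 : ∑ j, t j * x j k = ∑ j, (x j k - x i k) * t j := by
      simp only [sub_mul, Finset.sum_sub_distrib, ← Finset.mul_sum, ht, mul_zero, sub_zero]
      exact Finset.sum_congr rfl fun _ _ => mul_comm _ _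
    simp only [Finset.sum_apply, Pi.smul_apply, smul_eq_mul]
    rw [h1, Fintype.sum_eq_add_sum_subtype_ne _ i]
    simp [coordMatrix, Matrix.mulVec, dotProduct]
  have hcard : Module.finrank ℝ (EuclideanSpace ℝ {j : Fin n // j ≠ i}) = n - 2 + 1 := by
    rw [finrank_euclideanSpace]
    simp [Fintype.card_subtype_compl]
    omega
  have h := (Matrix.toEuclideanLin (coordMatrix x i)).singularValues_mul_norm_le hcard
    (WithLp.toLp 2 fun j : {j : Fin n // j ≠ i} => t j)
  rw [Matrix.toLpLin_toLp, Matrix.toLin'_apply, hmul] at h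
  refine le_trans (mul_le_mul_of_nonneg_right ?_ (norm_nonneg _)) h
  exact ciInf_le (Set.finite_range _).bddBelow i

theorem sum_abs_le_sqrt_card_mul_norm {ι : Type*} [Fintype ι] (z : ι → ℝ) :
    ∑ j, |z j| ≤ Real.sqrt (Fintype.card ι) * ‖WithLp.toLp 2 z‖ := by
  rw [EuclideanSpace.norm_eq, ← Real.sqrt_mul (Nat.cast_nonneg _)]
  refine Real.le_sqrt_of_sq_le ?_
  simpa using sq_sum_le_card_mul_sum_sq (s := Finset.univ) (f := fun j => |z j|)

/-- A lower bound on the height of a simplex whose vertices are close to those of a simplex of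
known width. -/
theorem width_sub_le_norm_sum_smul {n : ℕ} (hn : 2 ≤ n) {x Q : Fin n → Fin n → ℝ} {b W : ℝ}
    (hb : 0 ≤ b) (hW : W ≤ simplexWidth x) (hbW : 2 * n * b ≤ W)
    (hQ : ∀ p i, |Q p i - x p i| ≤ b) {p i : Fin n} (hip : p ≠ i) {t : Fin n → ℝ}
    (ht : ∑ j, t j = 0) (htp : t p = 1) :
    W - 2 * n * b ≤ ‖WithLp.toLp 2 (∑ j, t j • Q j)‖ := by
  set z : {j : Fin n // j ≠ i} → ℝ := fun j => t j with hz
  set N := ‖WithLp.toLp 2 z‖ with hN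
  have h1N : 1 ≤ N := by
    have := PiLp.norm_apply_le (WithLp.toLp 2 z) ⟨p, hip⟩
    simpa [hz, htp] using this
  have hsz : ∑ j, |z j| ≤ Real.sqrt n * N := by
    refine (sum_abs_le_sqrt_card_mul_norm z).trans
      (mul_le_mul_of_nonneg_right (Real.sqrt_le_sqrt ?_) (norm_nonneg _))
    exact_mod_cast (Fintype.card_subtype_le _).trans (Fintype.card_fin n).le
  -- The weight at `i` is at most the absolute sum of the others, hence the factor 2.
  have hst : ∑ j, |t j| ≤ 2 * (Real.sqrt n * N) := by
    rw [Fintype.sum_eq_add_sum_subtype_ne _ i]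
    rw [Fintype.sum_eq_add_sum_subtype_ne _ i] at ht
    have : |t i| ≤ ∑ j, |z j| := by
      rw [eq_neg_of_add_eq_zero_left ht, abs_neg]
      exact Finset.abs_sum_le_sum_abs _ _
    linarith
  have hD : ‖WithLp.toLp 2 (∑ j, t j • (x j - Q j))‖ ≤ 2 * n * b * N := by
    have : ∀ k, |(∑ j, t j • (x j - Q j)) k| ≤ 2 * (Real.sqrt n * N) * b := by
      intro k
      simp only [Finset.sum_apply, Pi.smul_apply, smul_eq_mul, Pi.sub_apply]
      refine (Finset.abs_sum_le_sum_abs _ _).trans ?_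
      refine le_trans ?_ (mul_le_mul_of_nonneg_right hst hb)
      rw [Finset.sum_mul]
      refine Finset.sum_le_sum fun j _ => ?_
      rw [abs_mul, abs_sub_comm]
      exact mul_le_mul_of_nonneg_left (hQ j k) (abs_nonneg _)
    refine (norm_toLp_le_sqrt_mul (by positivity) this).trans (le_of_eq ?_)
    have hs : Real.sqrt n * Real.sqrt n = n := Real.mul_self_sqrt (Nat.cast_nonneg n)
    linear_combination (2 * N * b) * hs
  have hx := simplexWidth_mul_norm_le hn x i ht
  have hsplit : WithLp.toLp 2 (∑ j, t j • x j) =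
      WithLp.toLp 2 (∑ j, t j • Q j) + WithLp.toLp 2 (∑ j, t j • (x j - Q j)) := by
    rw [← WithLp.toLp_add, ← Finset.sum_add_distrib]
    simp [smul_sub]
  rw [hsplit] at hx
  have h3 := hx.trans (norm_add_le _ _)
  have h4 : W * N ≤ simplexWidth x * N := mul_le_mul_of_nonneg_right hW (norm_nonneg _)
  have h5 : (W - 2 * n * b) * 1 ≤ (W - 2 * n * b) * N :=
    mul_le_mul_of_nonneg_left h1N (by linarith)
  linarith

/-- A unit normal, inside the hyperplanes of constant coordinate sum, of the facet of a simplex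
opposite to the vertex `Q p`. -/
theorem exists_facet_normal {n : ℕ} {Q : Fin n → Fin n → ℝ} {m h : ℝ}
    (hQ : ∀ p, ∑ i, Q p i = m) (hh : 0 < h) {p i : Fin n} (hip : i ≠ p)
    (hdist : ∀ t : Fin n → ℝ, ∑ j, t j = 0 → t p = 1 →
      h ≤ ‖WithLp.toLp 2 (∑ j, t j • Q j)‖) :
    ∃ (v : Fin n → ℝ) (β : ℝ), ‖WithLp.toLp 2 v‖ = 1 ∧ v ⬝ᵥ 1 = 0 ∧
      (∀ q, q ≠ p → v ⬝ᵥ Q q = β) ∧ v ⬝ᵥ Q p ≤ β - h := by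
  let L : (Fin n → ℝ) →ₗ[ℝ] EuclideanSpace ℝ (Fin n) :=
    Fintype.linearCombination ℝ fun j => WithLp.toLp 2 (Q j)
  have hL : ∀ t, L t = WithLp.toLp 2 (∑ j, t j • Q j) := by
    intro t
    simp only [L, Fintype.linearCombination_apply, WithLp.toLp_sum, WithLp.toLp_smul]
  let U : Submodule ℝ (Fin n → ℝ) :=
    LinearMap.ker (∑ j, LinearMap.proj j) ⊓ LinearMap.ker (LinearMap.proj p)
  have hU : ∀ t : Fin n → ℝ, t ∈ U ↔ ∑ j, t j = 0 ∧ t p = 0 := by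
    intro t
    simp [U, LinearMap.mem_ker, LinearMap.sum_apply]
  let s : Fin n → Fin n → ℝ := fun q => Pi.single q 1 - Pi.single i 1
  have hs0 : ∀ q, ∑ j, s q j = 0 := by
    intro q
    simp [s, Finset.sum_sub_distrib]
  have hLs : ∀ q, L (s q) = WithLp.toLp 2 (Q q) - WithLp.toLp 2 (Q i) := by
    intro q
    simp [s, L, map_sub]
  -- Project `Q p - Q i` onto the direction of the facet. The residual `r` is again a sum-zero
  -- combination with weight 1 at `p`, so `hdist` bounds its length; `v` is `-r` normalised.
  obtain ⟨t, htU, htL⟩ := Submodule.mem_map.1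
    ((U.map L).starProjection_apply_mem (L (s p)))
  have hrperp := (U.map L).sub_starProjection_mem_orthogonal (L (s p))
  rw [← htL, ← map_sub] at hrperp
  set r := L (s p - t) with hr
  have hsum : ∑ j, (s p - t) j = 0 := by
    simp [Finset.sum_sub_distrib, hs0, ((hU t).1 htU).1]
  have hrh : h ≤ ‖r‖ := by
    rw [hr, hL]
    refine hdist _ hsum ?_
    simp [s, ((hU t).1 htU).2, hip.symm]
  have hrpos : 0 < ‖r‖ := hh.trans_le hrh
  have hri : ∀ u ∈ U, inner ℝ r (L u) = 0 := fun u hu =>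
    (Submodule.mem_orthogonal' _ _).1 hrperp _ (Submodule.mem_map_of_mem hu)
  let v : Fin n → ℝ := (-(‖r‖⁻¹ • r)).ofLp
  have hv : WithLp.toLp 2 v = -(‖r‖⁻¹ • r) := rfl
  have hdot : ∀ x : Fin n → ℝ, v ⬝ᵥ x = -(‖r‖⁻¹ * inner ℝ r (WithLp.toLp 2 x)) := by
    intro x
    have h1 : v ⬝ᵥ x = inner ℝ (WithLp.toLp 2 v) (WithLp.toLp 2 x) := by
      rw [EuclideanSpace.inner_toLp_toLp, dotProduct_comm]
      simp
    rw [h1, hv, inner_neg_left, real_inner_smul_left]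
  have hdiff : ∀ q, v ⬝ᵥ Q q = v ⬝ᵥ Q i - ‖r‖⁻¹ * inner ℝ r (L (s q)) := by
    intro q
    rw [hdot, hdot, hLs, inner_sub_right]
    ring
  refine ⟨v, v ⬝ᵥ Q i, ?_, ?_, ?_, ?_⟩
  · rw [hv, norm_neg, norm_smul, norm_inv, norm_norm, inv_mul_cancel₀ hrpos.ne']
  · have h1 : ∑ k, r k = 0 := by
      rw [hr, hL]
      simp only [Finset.sum_apply, Pi.smul_apply, smul_eq_mul]
      rw [Finset.sum_comm]
      simp only [← Finset.mul_sum, hQ]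
      rw [← Finset.sum_mul, hsum, zero_mul]
    rw [dotProduct_one]
    simp [v, ← Finset.mul_sum, h1]
  · intro q hq
    rw [hdiff q, hri, mul_zero, sub_zero]
    rw [hU]
    exact ⟨hs0 q, by simp [s, hq.symm, hip.symm]⟩
  · have h1 : inner ℝ r (L (s p)) = ‖r‖ * ‖r‖ := by
      have h2 : L (s p) = r + L t := by rw [hr, ← map_add, sub_add_cancel]
      rw [h2, inner_add_right, hri t htU, add_zero, real_inner_self_eq_norm_mul_norm]
    rw [hdiff p, h1, inv_mul_cancel_left₀ hrpos.ne']
    linarith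

/-- The stopping condition holds as soon as the confidence radius is small compared with the width
of the true simplex. -/
theorem stoppingCondition_of_width {n : ℕ} (hn : 2 ≤ n) {x Q : Fin n → Fin n → ℝ} {b W m : ℝ}
    (hb : 0 < b) (hW : W ≤ simplexWidth x) (hQs : ∀ p, ∑ i, Q p i = m)
    (hbW : ((2 * n + 3) * Real.sqrt n + 2 * n) * b ≤ W)
    (hQ : ∀ p i, |Q p i - x p i| ≤ b) : StoppingCondition Q b := by
  intro p
  have hn' : (0 : ℝ) < n := by exact_mod_cast (by omega : 0 < n)
  have hsn : 0 < Real.sqrt n := Real.sqrt_pos.2 hn'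
  have : Nontrivial (Fin n) := Fin.nontrivial_iff_two_le.2 hn
  obtain ⟨i, hi⟩ := exists_ne p
  have hpos : 0 < (2 * n + 3) * Real.sqrt n * b := by positivity
  obtain ⟨v, β, hv1, hv0, hvq, hvp⟩ := exists_facet_normal hQs
    (h := W - 2 * n * b) (by linarith) hi fun t ht htp =>
      width_sub_le_norm_sum_smul hn hb.le hW (by linarith) hQ hi.symm ht htp
  refine ⟨v, β - 2 * Real.sqrt n * b, ⟨hv1, fun q hq => ?_, ?_, hv0⟩, ?_⟩
  · rw [hvq q hq]
    ring
  · linarith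
  -- The height `W - 2 * n * b` loses `2 * √n * b` to the shifted hyperplane and `√n * b` to the
  -- box; the rest must be at least `2 * n * √n * b`, which is `hbW`.
  · refine le_csInf ⟨_, Q p, by simpa using hb, rfl⟩ ?_
    rintro _ ⟨y, hy, rfl⟩
    replace hy : ‖y - Q p‖ < b := hy
    have h1 : |v ⬝ᵥ (y - Q p)| ≤ Real.sqrt n * b := by
      refine (dotProduct_le_norm_mul_norm _ _).trans ?_
      rw [hv1, one_mul]
      exact norm_toLp_le_sqrt_mul hb.le fun i =>
        (norm_le_pi_norm (y - Q p) i).trans (le_of_lt hy)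
    rw [dotProduct_sub, abs_le] at h1
    dsimp only
    linarith [h1.2]

/-- The width of a simplex with vertices in the cube `[-1, 1] ^ n`. -/
theorem simplexWidth_le {n : ℕ} (hn : 2 ≤ n) {x : Fin n → Fin n → ℝ} (hx : ∀ p i, |x p i| ≤ 1) :
    simplexWidth x ≤ 2 * Real.sqrt n := by
  have : Nontrivial (Fin n) := Fin.nontrivial_iff_two_le.2 hn
  obtain ⟨i, j, hij⟩ := exists_pair_ne (Fin n)
  rcases le_total (simplexWidth x) 0 with h0 | h0
  · exact h0.trans (by positivity)
  have h := width_sub_le_norm_sum_smul hn le_rfl le_rfl (by simpa using h0)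
    (fun p i => by simp) hij (x := x) (Q := x)
    (t := Pi.single i 1 - Pi.single j 1) (by simp [Finset.sum_sub_distrib]) (by simp [hij])
  simp only [mul_zero, sub_zero] at h
  refine h.trans ?_
  rw [mul_comm]
  refine norm_toLp_le_sqrt_mul (by norm_num) fun k => ?_
  have : (∑ q, (Pi.single i 1 - Pi.single j 1 : Fin n → ℝ) q • x q) = x i - x j := by
    simp [sub_smul, Finset.sum_sub_distrib, Pi.single_apply]
  rw [this, Pi.sub_apply]
  linarith [abs_sub (x i k) (x j k), hx i k, hx j k]

/-- The stopping condition cannot hold while the confidence radius is large. -/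
theorem StoppingCondition.radius_le {n : ℕ} (hn : 2 ≤ n) {Q : Fin n → Fin n → ℝ} {b : ℝ}
    (hb : 0 < b) (hS : StoppingCondition Q b) (hQ : ∀ p i, |Q p i| ≤ 1) : (n + 1) * b ≤ 1 := by
  have hn' : (0 : ℝ) < n := by exact_mod_cast (by omega : 0 < n)
  have hsn : 0 < Real.sqrt n := Real.sqrt_pos.2 hn'
  have : Nontrivial (Fin n) := Fin.nontrivial_iff_two_le.2 hn
  obtain ⟨p, q, hpq⟩ := exists_pair_ne (Fin n)
  obtain ⟨v, c, ⟨hv1, hvq, -, -⟩, hbox⟩ := hS p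
  have h1 := hbox.trans (boxDistance_le Q hb p hv1 c)
  have h2 : v ⬝ᵥ (Q q - Q p) ≤ Real.sqrt n * 2 := by
    refine (le_abs_self _).trans ((dotProduct_le_norm_mul_norm _ _).trans ?_)
    rw [hv1, one_mul]
    refine norm_toLp_le_sqrt_mul (by norm_num) fun k => ?_
    rw [Pi.sub_apply]
    linarith [abs_sub (Q q k) (Q p k), hQ q k, hQ p k]
  rw [dotProduct_sub, hvq q hpq.symm] at h2
  have h3 : (2 * Real.sqrt n) * ((n + 1) * b) ≤ (2 * Real.sqrt n) * 1 := by linarith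
  exact le_of_mul_le_mul_left h3 (by positivity)

/-! ### Concentration of the estimates -/

section Sampling

variable {n : ℕ} {G : StochasticGame n} {Ω : Type*} [MeasurableSpace Ω] {Pr : Measure Ω}
  {r : ℕ → Finset (Fin n) → Ω → unitInterval}

/-- The deviation of a used reward `x` of the coalition `S` from its mean. -/
noncomputable def rewardDeviation (G : StochasticGame n) (S : Finset (Fin n))
    (x : unitInterval) : ℝ :=
  usedReward (expectedReward G Finset.univ) (fun _ => x) S - expectedReward G S

theorem usedReward_sub_expectedReward (ρ : Finset (Fin n) → unitInterval)
    (S : Finset (Fin n)) :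
    usedReward (expectedReward G Finset.univ) ρ S - expectedReward G S =
      rewardDeviation G S (ρ S) := rfl

theorem measurable_usedReward_const (μN : ℝ) (S : Finset (Fin n)) :
    Measurable fun x : unitInterval => usedReward μN (fun _ => x) S := by
  unfold usedReward
  split_ifs
  · exact measurable_const
  · exact measurable_const
  · exact measurable_subtype_coe

theorem measurable_rewardDeviation (S : Finset (Fin n)) : Measurable (rewardDeviation G S) :=
  (measurable_usedReward_const _ S).sub_const _

/-- Hoeffding's lemma for a variable in `[0, 1]`. For the empty and the grand coalition the used
reward is constant and equals the mean. -/
theorem hasSubgaussianMGF_rewardDeviation [IsProbabilityMeasure Pr] (h0 : expectedReward G ∅ = 0)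
    (hr : IsSampling G Pr r) (s : ℕ) (S : Finset (Fin n)) :
    HasSubgaussianMGF (fun ω => rewardDeviation G S (r s S ω)) (1 / 4) Pr := by
  have hm := (measurable_usedReward_const (expectedReward G Finset.univ) S).comp
    (hr.measurable s S)
  have h := hasSubgaussianMGF_of_mem_Icc (μ := Pr) (a := 0) (b := 1) hm.aemeasurable
    (ae_of_all _ fun ω => usedReward_mem_Icc (expectedReward_mem_Icc G _) (fun _ => r s S ω) S)
  have hint : ∫ ω, ((fun x : unitInterval => usedReward (expectedReward G Finset.univ)
      (fun _ => x) S) ∘ r s S) ω ∂Pr = expectedReward G S := by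
    unfold usedReward
    split_ifs with h1 h2
    · simp [h1, h0]
    · simp [h2]
    · rw [expectedReward, ← hr.law s S,
        integral_map (hr.measurable s S).aemeasurable (by fun_prop)]
      rfl
  rw [hint] at h
  have hc : (1 / 4 : NNReal) = (‖(1 : ℝ) - 0‖₊ / 2) ^ 2 := by
    ext
    norm_num
  rw [hc]
  exact h

/-- Hoeffding's inequality for the estimate of a marginal contribution; the two coalitions are
sampled independently. -/
theorem measure_signed_marginal_ge_le [IsProbabilityMeasure Pr] (h0 : expectedReward G ∅ = 0)
    (hr : IsSampling G Pr r) {P P' : Finset (Fin n)} (hP : P ≠ P') {σ : ℝ} (hσ : σ = 1 ∨ σ = -1)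
    (ep : ℕ) {ε : ℝ} (hε : 0 ≤ ε) :
    Pr.real {ω | ε ≤ σ * ∑ s ∈ Finset.Icc 1 ep,
      (rewardDeviation G P (r s P ω) - rewardDeviation G P' (r s P' ω))} ≤
      Real.exp (-(ε ^ 2 / ep)) := by
  -- Signs turn the difference into one sum of `2 * ep` independent terms, indexed by epoch and
  -- coalition, with total variance proxy `ep / 2`.
  let sg : Finset (Fin n) → ℝ := fun S => if S = P then σ else -σ
  have hsg : ∀ S, sg S = 1 ∨ sg S = -1 := by
    intro S
    rcases hσ with rfl | rfl <;> by_cases h : S = P <;> simp [sg, h]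
  have hind := hr.indep.comp (fun a x => sg a.2 * rewardDeviation G a.2 x)
    fun a => (measurable_rewardDeviation a.2).const_mul _
  have hsub : ∀ a ∈ Finset.Icc 1 ep ×ˢ {P, P'}, HasSubgaussianMGF
      ((fun x => sg a.2 * rewardDeviation G a.2 x) ∘ r a.1 a.2) (1 / 4) Pr := by
    intro a _
    have h := hasSubgaussianMGF_rewardDeviation h0 hr a.1 a.2
    rcases hsg a.2 with h1 | h1
    · simpa [Function.comp_def, h1] using h
    · simpa [Function.comp_def, Pi.neg_def, h1] using h.neg
  have h := HasSubgaussianMGF.measure_sum_ge_le_of_iIndepFun hind hsub hε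
  have hc : (((∑ _a ∈ Finset.Icc 1 ep ×ˢ {P, P'}, 1 / 4 : NNReal)) : ℝ) = ep / 2 := by
    rw [Finset.sum_const, Finset.card_product, Finset.card_pair hP]
    simp
    ring
  have hexp : -ε ^ 2 / (2 * (ep / 2 : ℝ)) = -(ε ^ 2 / ep) := by
    rw [mul_div_cancel₀ _ two_ne_zero, neg_div]
  rw [hc, hexp] at h
  convert h using 5 with ω
  rw [Finset.sum_product, Finset.mul_sum]
  refine Finset.sum_congr rfl fun s _ => ?_
  rw [Finset.sum_pair hP]
  simp only [Function.comp_apply, sg, if_true, hP.symm, if_false]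
  ring

theorem measure_abs_empiricalMarginal_sub_ge_le [IsProbabilityMeasure Pr]
    (h0 : expectedReward G ∅ = 0) (hr : IsSampling G Pr r) (w : Equiv.Perm (Fin n)) (i : Fin n)
    {ep : ℕ} (hep : 1 ≤ ep) {b : ℝ} (hb : 0 ≤ b) :
    Pr.real {ω | b ≤ |empiricalMarginal (expectedReward G Finset.univ) (fun s S => r s S ω) w ep i -
      marginalVector G w i|} ≤ 2 * Real.exp (-(ep * b ^ 2)) := by
  have hpos : (0 : ℝ) < ep := by exact_mod_cast hep
  set P := prefixSet w i with hPdef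
  have hP : P ≠ P.erase i := by
    intro h
    have : i ∈ P.erase i := h ▸ (by simp [hPdef, prefixSet] : i ∈ P)
    simp at this
  have heq : ∀ ω, (ep : ℝ) * (empiricalMarginal (expectedReward G Finset.univ)
      (fun s S => r s S ω) w ep i - marginalVector G w i) = ∑ s ∈ Finset.Icc 1 ep,
      (rewardDeviation G P (r s P ω) - rewardDeviation G (P.erase i) (r s (P.erase i) ω)) := by
    intro ω
    have hdev : ∀ s S, rewardDeviation G S (r s S ω) =
        usedReward (expectedReward G Finset.univ) (fun S => r s S ω) S - expectedReward G S :=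
      fun s S => (usedReward_sub_expectedReward (fun S => r s S ω) S).symm
    simp only [hdev, empiricalMarginal, marginalVector, ← hPdef]
    simp only [Finset.sum_sub_distrib, Finset.sum_const, Nat.card_Icc, add_tsub_cancel_right,
      nsmul_eq_mul]
    field_simp
    ring
  have hε : 0 ≤ ep * b := by positivity
  have hexp : ((ep : ℝ) * b) ^ 2 / ep = ep * b ^ 2 := by
    field_simp
  have h1 := measure_signed_marginal_ge_le h0 hr hP (Or.inl rfl) ep hε
  have h2 := measure_signed_marginal_ge_le h0 hr hP (Or.inr rfl) ep hε
  rw [hexp] at h1 h2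
  rw [two_mul]
  refine le_trans ?_ (add_le_add h1 h2)
  refine le_trans (measureReal_mono ?_) (measureReal_union_le _ _)
  intro ω hω
  simp only [Set.mem_union, Set.mem_ofPred_eq, ← heq] at hω ⊢
  rcases le_abs.1 hω with h | h
  · left
    rw [one_mul]
    exact mul_le_mul_of_nonneg_left h hpos.le
  · right
    rw [neg_one_mul, ← mul_neg]
    exact mul_le_mul_of_nonneg_left h hpos.le

/-- Telescoping. The union bound over epochs must start at 3: from epoch 1 or 2 the sum of `2 / ep ^
2` exceeds 1. -/
theorem sum_range_two_div_sq_le (m : ℕ) :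
    ∑ k ∈ Finset.range m, 2 / ((k : ℝ) + 3) ^ 2 ≤ 1 - 2 / ((m : ℝ) + 2) := by
  induction m with
  | zero => simp
  | succ m ih =>
    rw [Finset.sum_range_succ]
    have h : 2 / ((m : ℝ) + 3) ^ 2 ≤ 2 / (m + 2) - 2 / (m + 3) := by
      rw [div_sub_div _ _ (by positivity) (by positivity), div_le_div_iff₀ (by positivity)
        (by positivity)]
      nlinarith [(Nat.cast_nonneg m : (0 : ℝ) ≤ m)]
    push_cast
    have : (m : ℝ) + 1 + 2 = m + 3 := by ring
    rw [this]
    linarith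

theorem mul_sq_confidenceBonus {δ : ℝ} (hn : 1 ≤ n) (hδ : 0 < δ) (hδ1 : δ ≤ 1) {ep : ℕ}
    (hep : 1 ≤ ep) : ep * confidenceBonus n δ ep ^ 2 = 2 * Real.log (n * ep * δ⁻¹) := by
  have hpos : (0 : ℝ) < ep := by exact_mod_cast hep
  have hn' : (1 : ℝ) ≤ n := by exact_mod_cast hn
  have hep' : (1 : ℝ) ≤ ep := by exact_mod_cast hep
  have h1 : 1 ≤ (n : ℝ) * ep * δ⁻¹ :=
    one_le_mul_of_one_le_of_one_le (one_le_mul_of_one_le_of_one_le hn' hep')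
      ((one_le_inv₀ hδ).2 hδ1)
  have := Real.log_nonneg h1
  rw [confidenceBonus, Real.sq_sqrt (by positivity)]
  field_simp

/-- With probability at least `1 - δ`, all estimates from the third epoch on are within the
confidence radius. -/
theorem measure_confidence_ge [IsProbabilityMeasure Pr] (h0 : expectedReward G ∅ = 0)
    (hr : IsSampling G Pr r) {δ : ℝ} (hn : 1 ≤ n) (hδ : 0 < δ) (hδ1 : δ ≤ 1)
    (w : Fin n → Equiv.Perm (Fin n)) :
    ENNReal.ofReal (1 - δ) ≤ Pr {ω | ∀ ep, 3 ≤ ep → ∀ p i,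
      |empiricalMarginal (expectedReward G Finset.univ) (fun s S => r s S ω) (w p) ep i -
        marginalVector G (w p) i| < confidenceBonus n δ ep} := by
  have hn' : (0 : ℝ) < n := by exact_mod_cast hn
  set B : ℕ → Fin n → Fin n → Set Ω := fun ep p i => {ω | confidenceBonus n δ ep ≤
    |empiricalMarginal (expectedReward G Finset.univ) (fun s S => r s S ω) (w p) ep i -
        marginalVector G (w p) i|} with hB
  have hBm : ∀ k p i, Pr (B (k + 3) p i) ≤
      ENNReal.ofReal (2 * (δ / (n * (k + 3))) ^ 2) := by
    intro k p i
    have h := measure_abs_empiricalMarginal_sub_ge_le h0 hr (w p) i (ep := k + 3) (by omega)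
      (b := confidenceBonus n δ (k + 3)) (Real.sqrt_nonneg _)
    rw [mul_sq_confidenceBonus hn hδ hδ1 (by omega)] at h
    -- The factor 2 inside the confidence bonus makes the tail a square, which pays for the `n ^ 2`
    -- pairs and for summability over epochs.
    have hL : Real.exp (-(2 * Real.log (n * (k + 3 : ℕ) * δ⁻¹))) =
        (δ / (n * (k + 3))) ^ 2 := by
      have hp : (0 : ℝ) < n * (k + 3 : ℕ) * δ⁻¹ := by positivity
      rw [← mul_neg, ← Real.log_inv, two_mul, Real.exp_add, Real.exp_log (inv_pos.2 hp), ← sq]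
      push_cast
      congr 1
      field_simp
    rw [hL] at h
    exact (ENNReal.le_ofReal_iff_toReal_le (measure_ne_top _ _) (by positivity)).2 h
  set bad : Set Ω := ⋃ k, ⋃ p, ⋃ i, B (k + 3) p i with hbad
  have hbadm : Pr bad ≤ ENNReal.ofReal δ := by
    have h1 : ∀ k, Pr (⋃ p, ⋃ i, B (k + 3) p i) ≤
        ENNReal.ofReal (δ * (2 / ((k : ℝ) + 3) ^ 2)) := by
      intro k
      calc Pr (⋃ p, ⋃ i, B (k + 3) p i)
          ≤ ∑ p, ∑ i, Pr (B (k + 3) p i) := (measure_iUnion_fintype_le _ _).trans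
            (Finset.sum_le_sum fun p _ => measure_iUnion_fintype_le _ _)
        _ ≤ ∑ _p : Fin n, ∑ _i : Fin n, ENNReal.ofReal (2 * (δ / (n * (k + 3))) ^ 2) :=
            Finset.sum_le_sum fun p _ => Finset.sum_le_sum fun i _ => hBm k p i
        _ = ENNReal.ofReal (n * (n * (2 * (δ / (n * (k + 3))) ^ 2))) := by
            simp [ENNReal.ofReal_mul, hn'.le]
        _ ≤ ENNReal.ofReal (δ * (2 / ((k : ℝ) + 3) ^ 2)) := by
            apply ENNReal.ofReal_le_ofReal
            have : (n : ℝ) * (n * (2 * (δ / (n * (k + 3))) ^ 2)) =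
                (δ * (2 / ((k : ℝ) + 3) ^ 2)) * δ := by
              field_simp
            rw [this]
            exact mul_le_of_le_one_right (by positivity) hδ1
    refine (measure_iUnion_le _).trans ((ENNReal.tsum_le_tsum h1).trans ?_)
    refine ENNReal.tsum_le_of_sum_range_le fun m => ?_
    rw [← ENNReal.ofReal_sum_of_nonneg fun k _ => by positivity]
    apply ENNReal.ofReal_le_ofReal
    rw [← Finset.mul_sum]
    have h2 := sum_range_two_div_sq_le m
    have h3 : 0 ≤ 2 / ((m : ℝ) + 2) := by positivity
    exact mul_le_of_le_one_right hδ.le (by linarith)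
  have hsub : badᶜ ⊆ {ω | ∀ ep, 3 ≤ ep → ∀ p i,
      |empiricalMarginal (expectedReward G Finset.univ) (fun s S => r s S ω) (w p) ep i -
        marginalVector G (w p) i| < confidenceBonus n δ ep} := by
    intro ω hω ep hep p i
    by_contra hcon
    refine hω (Set.mem_iUnion.2 ⟨ep - 3, Set.mem_iUnion.2 ⟨p, Set.mem_iUnion.2 ⟨i, ?_⟩⟩⟩)
    rw [Nat.sub_add_cancel hep]
    exact not_lt.1 hcon
  refine le_trans ?_ (measure_mono hsub)
  rw [ENNReal.ofReal_sub _ hδ.le, ENNReal.ofReal_one, tsub_le_iff_right]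
  -- Subadditivity suffices, so no measurability of `bad` is needed.
  calc (1 : ENNReal) = Pr Set.univ := measure_univ.symm
    _ ≤ Pr badᶜ + Pr bad := by
        rw [← Set.compl_union_self bad]
        exact measure_union_le _ _
    _ ≤ Pr badᶜ + ENNReal.ofReal δ := by gcongr

end Sampling

/-! ### Bounds on the stopping epoch -/

theorem half_le_log_of_two_le {x : ℝ} (hx : 2 ≤ x) : 1 / 2 ≤ Real.log x := by
  have := Real.log_le_log two_pos hx
  linarith [Real.log_two_gt_d9]

theorem two_le_mul_mul_inv {n ep : ℕ} {δ : ℝ} (hn : 2 ≤ n) (hδ : 0 < δ) (hδ1 : δ ≤ 1)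
    (hep : 1 ≤ ep) : 2 ≤ (n : ℝ) * ep * δ⁻¹ := by
  have hn' : (2 : ℝ) ≤ n := by exact_mod_cast hn
  have hep' : (1 : ℝ) ≤ ep := by exact_mod_cast hep
  have h1 := (one_le_inv₀ hδ).2 hδ1
  calc (2 : ℝ) = 2 * 1 * 1 := by norm_num
    _ ≤ (n : ℝ) * ep * δ⁻¹ := by gcongr

theorem confidenceBonus_pos {n ep : ℕ} {δ : ℝ} (hn : 2 ≤ n) (hδ : 0 < δ) (hδ1 : δ ≤ 1)
    (hep : 1 ≤ ep) : 0 < confidenceBonus n δ ep := by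
  have h := half_le_log_of_two_le (two_le_mul_mul_inv hn hδ hδ1 hep)
  have hpos : (0 : ℝ) < ep := by exact_mod_cast hep
  apply Real.sqrt_pos.2
  have : 0 < Real.log (n * ep * δ⁻¹) := by linarith
  positivity

/-- The algorithm does not stop in the first two epochs. -/
theorem three_le_of_mul_confidenceBonus_le {n ep : ℕ} {δ : ℝ} (hn : 2 ≤ n) (hδ : 0 < δ)
    (hδ1 : δ ≤ 1) (hep : 1 ≤ ep) (h : (n + 1) * confidenceBonus n δ ep ≤ 1) : 3 ≤ ep := by
  have hn' : (2 : ℝ) ≤ n := by exact_mod_cast hn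
  have hb := confidenceBonus_pos hn hδ hδ1 hep
  have h1 : 3 * confidenceBonus n δ ep ≤ 1 :=
    (mul_le_mul_of_nonneg_right (by linarith) hb.le).trans h
  have h2 : confidenceBonus n δ ep ^ 2 ≤ (1 / 3) ^ 2 :=
    pow_le_pow_left₀ hb.le (by linarith) 2
  have h3 := mul_sq_confidenceBonus (by omega : 1 ≤ n) hδ hδ1 hep
  have h4 := half_le_log_of_two_le (two_le_mul_mul_inv hn hδ hδ1 hep)
  have hpos : (0 : ℝ) ≤ ep := Nat.cast_nonneg ep
  have h5 := mul_le_mul_of_nonneg_left h2 hpos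
  have h6 : (3 : ℝ) ≤ ep := by linarith
  exact_mod_cast h6

/-- A number of epochs after which the confidence radius is small compared with the width `n / ρ`,
where `L = n * ρ / δ`. -/
theorem exists_epoch {n : ℕ} {ρ δ : ℝ} (hn : 2 ≤ n) (hρ : 0 < ρ) (hδ : 0 < δ) (hδ1 : δ ≤ 1)
    (hnρ : n ≤ 4 * ρ ^ 2) :
    ∃ N : ℕ, 3 ≤ N ∧ (N : ℝ) ≤ 4096 * (n * ρ ^ 2 * Real.log (n * ρ * δ⁻¹)) ∧
      ((2 * n + 3) * Real.sqrt n + 2 * n) * confidenceBonus n δ N ≤ n / ρ := by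
  have hn' : (2 : ℝ) ≤ n := by exact_mod_cast hn
  have hδi := (one_le_inv₀ hδ).2 hδ1
  set L := (n : ℝ) * ρ * δ⁻¹ with hLdef
  have hLpos : 0 < L := by positivity
  have hnρ1 : 1 ≤ n * ρ ^ 2 := by nlinarith
  have hL2' : n ^ 2 * ρ ^ 2 * δ⁻¹ ≤ L ^ 2 := by
    have : L ^ 2 = n ^ 2 * ρ ^ 2 * δ⁻¹ * δ⁻¹ := by rw [hLdef]; ring
    rw [this]
    exact le_mul_of_one_le_right (by positivity) hδi
  have hL2 : 2 ≤ L ^ 2 := by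
    have : n ^ 2 * ρ ^ 2 * 1 ≤ n ^ 2 * ρ ^ 2 * δ⁻¹ := by gcongr
    nlinarith
  have hlog2 : Real.log 2 ≤ 2 * Real.log L := by
    have := Real.log_le_log two_pos hL2
    rwa [Real.log_pow] at this
  have hlogL : 1 / 4 ≤ Real.log L := by linarith [Real.log_two_gt_d9]
  have hlogle : Real.log L ≤ L := (Real.log_le_sub_one_of_pos hLpos).trans (by linarith)
  set A := n * ρ ^ 2 * Real.log L with hA
  have hA4 : 1 / 4 ≤ A := by
    calc (1 : ℝ) / 4 ≤ 1 * Real.log L := by linarith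
      _ ≤ A := mul_le_mul_of_nonneg_right hnρ1 (by linarith)
  refine ⟨⌈2048 * A⌉₊, ?_, ?_, ?_⟩
  · have : (3 : ℝ) ≤ (⌈2048 * A⌉₊ : ℝ) := (by linarith : (3 : ℝ) ≤ 2048 * A).trans (Nat.le_ceil _)
    exact_mod_cast this
  · have := Nat.ceil_lt_add_one (by linarith : 0 ≤ 2048 * A)
    linarith
  · set N := ⌈2048 * A⌉₊ with hN
    have hNle : (N : ℝ) ≤ 4096 * A := by
      have := Nat.ceil_lt_add_one (by linarith : 0 ≤ 2048 * A)
      linarith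
    have hNge : 2048 * A ≤ N := Nat.le_ceil _
    have hN1 : 1 ≤ N := by
      have : (0 : ℝ) < N := by linarith
      exact_mod_cast this
    have hNpos : (0 : ℝ) < N := by exact_mod_cast hN1
    -- `12 * log 2 + 3 * log L`, with `log 2 ≤ 2 * log L`, gives 27.
    have hlogN : Real.log (n * N * δ⁻¹) ≤ 27 * Real.log L := by
      have h1 : n * N * δ⁻¹ ≤ 2 ^ 12 * L ^ 3 := by
        calc n * N * δ⁻¹ ≤ n * (4096 * (n * ρ ^ 2 * L)) * δ⁻¹ := by
              gcongr
              exact hNle.trans (by rw [hA]; gcongr)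
          _ = 2 ^ 12 * (n ^ 2 * ρ ^ 2 * δ⁻¹ * L) := by ring
          _ ≤ 2 ^ 12 * (L ^ 2 * L) := by gcongr
          _ = 2 ^ 12 * L ^ 3 := by ring
      have h2 := Real.log_le_log (by positivity) h1
      rw [Real.log_mul (x := 2 ^ 12) (by positivity) (by positivity), Real.log_pow,
        Real.log_pow] at h2
      push_cast at h2
      linarith
    have hb2 := mul_sq_confidenceBonus (by omega : 1 ≤ n) hδ hδ1 hN1
    set b := confidenceBonus n δ N with hb
    have hbpos : 0 < b := confidenceBonus_pos hn hδ hδ1 hN1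
    -- The 25 is the square of the 5 in `hcoef`; then `25 * 2 * 27 = 1350 ≤ 2048`.
    have hbρ : 25 * n * ρ ^ 2 * b ^ 2 ≤ 1 := by
      have h1 : (N : ℝ) * (25 * n * ρ ^ 2 * b ^ 2) ≤ N * 1 := by
        calc (N : ℝ) * (25 * n * ρ ^ 2 * b ^ 2) = 25 * n * ρ ^ 2 * (N * b ^ 2) := by ring
          _ ≤ 25 * n * ρ ^ 2 * (2 * (27 * Real.log L)) := by
              rw [hb2]
              gcongr
          _ = 1350 * A := by rw [hA]; ring
          _ ≤ N * 1 := by linarith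
      exact le_of_mul_le_mul_left h1 hNpos
    set q := Real.sqrt n with hq
    have hqq : q ^ 2 = n := Real.sq_sqrt (by linarith)
    have hqpos : 0 < q := Real.sqrt_pos.2 (by linarith)
    have hq1 : 4 / 3 ≤ q := Real.le_sqrt_of_sq_le (by linarith)
    have h5 : 5 * q * ρ * b ≤ 1 := by
      refine (abs_le_one_iff_mul_self_le_one.2 ?_ |> (le_abs_self _).trans)
      calc 5 * q * ρ * b * (5 * q * ρ * b) = 25 * q ^ 2 * ρ ^ 2 * b ^ 2 := by ring
        _ ≤ 1 := by rw [hqq]; exact hbρ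
    have hcoef : (2 * n + 3) * q + 2 * n ≤ 5 * q * n := by
      nlinarith [mul_le_mul_of_nonneg_left hq1 (by linarith : (0 : ℝ) ≤ n),
        mul_le_mul_of_nonneg_left hn' hqpos.le]
    rw [le_div_iff₀ hρ]
    calc ((2 * n + 3) * q + 2 * n) * b * ρ ≤ 5 * q * n * b * ρ := by gcongr
      _ = n * (5 * q * ρ * b) := by ring
      _ ≤ n * 1 := by gcongr
      _ = n := mul_one _

/-! ### Main theorem -/

theorem theorem5 :
    ∃ K : ℝ, 0 < K ∧
      ∀ (n : ℕ) (G : StochasticGame n) (ς cW δ : ℝ),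
        2 ≤ n → 0 < ς → 0 < cW → 0 < δ → δ ≤ 1 →
        expectedReward G ∅ = 0 →
        IsStrictlyConvexGame G ς →
        (n : ℝ) * ς / cW ≤ simplexWidth (fun p => marginalVector G (cyclicPerms n p)) →
        ∀ {Ω : Type*} [MeasurableSpace Ω] (Pr : Measure Ω) [IsProbabilityMeasure Pr]
          (r : ℕ → Finset (Fin n) → Ω → unitInterval), IsSampling G Pr r →
          ENNReal.ofReal (1 - δ) ≤
            Pr {ω | ∃ (x : Fin n → ℝ) (T : ℕ),
              CommonPointsPickingReturns (cyclicPerms n) (expectedReward G Finset.univ) δ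
                (fun s S => r s S ω) x T ∧
              x ∈ expectedCore G ∧
              (T : ℝ) ≤ K * ((n : ℝ) ^ 5 * cW ^ 4 *
                Real.log ((n : ℝ) * cW * δ⁻¹ * ς⁻¹) / ς ^ 4)} := by
  refine ⟨4096, by norm_num, ?_⟩
  intro n G ς cW δ hn hς hcW hδ hδ1 h0 hconv hwidth Ω _ Pr _ r hr
  refine (measure_confidence_ge h0 hr (by omega) hδ hδ1 (cyclicPerms n)).trans
    (measure_mono fun ω hω => ?_)
  replace hω : ∀ ep, 3 ≤ ep → ∀ p i, |empiricalMarginal (expectedReward G Finset.univ)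
      (fun s S => r s S ω) (cyclicPerms n p) ep i - marginalVector G (cyclicPerms n p) i| <
        confidenceBonus n δ ep := hω
  have hn' : (2 : ℝ) ≤ n := by exact_mod_cast hn
  set ρ := cW / ς with hρdef
  have hρ : 0 < ρ := div_pos hcW hς
  have hW : (n : ℝ) / ρ ≤ simplexWidth fun p => marginalVector G (cyclicPerms n p) := by
    rwa [hρdef, div_div_eq_mul_div]
  -- Vertices in the cube force width at most `2 * √n`. This keeps `ρ` away from 0, so the logarithm
  -- in the bound is positive.
  have hnρ : (n : ℝ) ≤ 4 * ρ ^ 2 := by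
    have h1 := hW.trans (simplexWidth_le hn fun p i => abs_marginalVector_le_one G _ i)
    rw [div_le_iff₀ hρ] at h1
    have h2 : (n : ℝ) ^ 2 ≤ (2 * Real.sqrt n * ρ) ^ 2 := pow_le_pow_left₀ (by linarith) h1 2
    rw [mul_pow, mul_pow, Real.sq_sqrt (by linarith)] at h2
    nlinarith
  obtain ⟨N, hN3, hNle, hNb⟩ := exists_epoch hn hρ hδ hδ1 hnρ
  set μN := expectedReward G Finset.univ with hμN
  set rew : ℕ → Finset (Fin n) → unitInterval := fun s S => r s S ω with hrew
  have hsum : ∀ ep, 1 ≤ ep → ∀ p, ∑ i, empiricalMarginal μN rew (cyclicPerms n p) ep i = μN :=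
    fun ep hep p => sum_empiricalMarginal (by omega) μN rew _ hep
  have hcondN : StopsAtEpoch (cyclicPerms n) μN δ rew N :=
    stoppingCondition_of_width hn (confidenceBonus_pos hn hδ hδ1 (by omega)) hW
      (hsum N (by omega)) hNb fun p i => (hω N hN3 p i).le
  classical
  have hex : ∃ ep, 1 ≤ ep ∧ StopsAtEpoch (cyclicPerms n) μN δ rew ep := ⟨N, by omega, hcondN⟩
  obtain ⟨hep1, hcond⟩ := Nat.find_spec hex
  set ep := Nat.find hex with hepdef
  have hepN : ep ≤ N := Nat.find_min' hex ⟨by omega, hcondN⟩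
  have hbpos := confidenceBonus_pos hn hδ hδ1 hep1
  have hep3 : 3 ≤ ep := three_le_of_mul_confidenceBonus_le hn hδ hδ1 hep1
    (StoppingCondition.radius_le hn hbpos hcond fun p i =>
      abs_empiricalMarginal_le_one (expectedReward_mem_Icc G _) rew _ hep1 i)
  refine ⟨_, _, ⟨ep, hep1, hcond, fun k hk1 hk hks => Nat.find_min hex hk ⟨hk1, hks⟩, rfl, rfl⟩,
    ?_, ?_⟩
  · refine mean_mem_expectedCore (by omega) hbpos hcond (hsum ep hep1)
      (y := fun p => marginalVector G (cyclicPerms n p))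
      (fun p => marginalVector_mem_expectedCore h0 hconv.1 _) fun p i => ?_
    rw [abs_sub_comm]
    exact (hω ep hep3 p i).le
  · have hLeq : (n : ℝ) * cW * δ⁻¹ * ς⁻¹ = n * ρ * δ⁻¹ := by
      rw [hρdef]
      field_simp
    have hgoal : (n : ℝ) ^ 5 * cW ^ 4 * Real.log (n * ρ * δ⁻¹) / ς ^ 4 =
        (n * ρ ^ 2 * Real.log (n * ρ * δ⁻¹)) * (n ^ 4 * ρ ^ 2) := by
      rw [hρdef]
      field_simp
    have hA : 0 ≤ 4096 * (n * ρ ^ 2 * Real.log (n * ρ * δ⁻¹)) := (Nat.cast_nonneg N).trans hNle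
    have hepR : (ep : ℝ) ≤ N := by exact_mod_cast hepN
    -- The epoch bound already gives order `n ^ 3 * ρ ^ 2 * log`; the stated `n ^ 5 * ρ ^ 4 * log`
    -- follows since `1 ≤ n ^ 2 * ρ ^ 2`.
    have hn2 : (n : ℝ) * n ≤ n ^ 4 * ρ ^ 2 := by
      have h1 : 1 ≤ n * n * ρ ^ 2 := by nlinarith
      calc (n : ℝ) * n = n * n * 1 := (mul_one _).symm
        _ ≤ n * n * (n * n * ρ ^ 2) := by gcongr
        _ = n ^ 4 * ρ ^ 2 := by ring
    rw [hLeq, hgoal]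
    push_cast
    calc (ep : ℝ) * (n * n)
        ≤ 4096 * (n * ρ ^ 2 * Real.log (n * ρ * δ⁻¹)) * (n ^ 4 * ρ ^ 2) :=
          mul_le_mul (hepR.trans hNle) hn2 (by positivity) hA
      _ = _ := by ring
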